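/- Let $D\ge 3$ and consider the FLRW metrics $$ds^2_{a,F}=-F(t)\,dt^2+\frac{a(t)^2}{1-kr^2}\,dr^2+a(t)^2r^2\,d\Omega^2_{D-2},\qquad k\in\{-1,0,1\},$$ where $a\neq 0$ and $F>0$ are $C^2$ functions on an open set of times, $r>0$, $kr^2<1$, and $d\Omega^2_{D-2}$ is the metric of the round unit $(D-2)$-sphere. Let $R_{abcd}$ be the Riemann tensor in the conventions $R_{abc}{}^{d}=-2\partial_{[a}\Gamma_{b]c}{}^{d}+2\Gamma_{c[a}{}^{e}\Gamma_{b]e}{}^{d}$, where $\Gamma_{ab}{}^{c}$ are the Christoffel symbols, let $R_{ab}=R_{adb}{}^{d}$ be the Ricci tensor, $R=R_b{}^b$ the Ricci scalar, $Z_{ab}=R_{ab}-\frac1D g_{ab}R$ the traceless Ricci tensor and $W_{abcd}$ the Weyl tensor. For the metric $ds^2_{a,F}$ one has $$R=\Sigma,\qquad Z_a{}^b=\Gamma\,(-D\,\delta_a^t\delta_t^b+\delta_a^b),$$ $$\Sigma=\frac{(D-1)\left((D-2)kF^2+(D-2)F\dot a^2-a\dot a\dot F+2a\ddot aF\right)}{a^2F^2},\qquad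 \Gamma=\frac{(D-2)\left(2kF^2+2F\dot a^2+a\dot a\dot F-2a\ddot aF\right)}{2a^2F^2D}.$$ For $m,p,q\ge 0$ let $(R^mW^pZ^q)_i$ denote any scalar obtained from the product of $m$ Ricci scalars, $p$ Weyl tensors and $q$ traceless Ricci tensors by contracting all the indices in pairs with the metric (according to a pairing of the index slots, labelled by $i$). Then, on all FLRW metrics $ds^2_{a,F}$ of dimension $D$: 1. if $p\ge 1$, then $(R^mW^pZ^q)_i|_{a,F}=0$; 2. if $p=0$, then $(R^mZ^q)_i|_{a,F}=c_i\,\Sigma^m\,\Gamma^q$ for a real constant $c_i$ that depends only on $D$, $m$, $q$ and the contraction $i$, and not on $k$, $a$, $F$ or the point; 3. all invariants of the same type $(m,p,q)$ that are non-zero on FLRW metrics are proportional to each other there: if $(R^mW^pZ^q)_j$ does not vanish on all of these metrics, then for every $i$ there is a real constant $c$ with $(R^mW^pZ^q)_i|_{a,F}=c\,(R^mW^pZ^q)_j|_{a,F}$ for all $k$, $a$, $F$ and at all points. -/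

import Mathlib

open scoped BigOperators

/-! ### Curvature of a (pseudo-)Riemannian metric in a coordinate chart

A metric in a chart with index type `ι` is a matrix-valued function `g` of the coordinates; its value
at `x` has the entries `g_{ab}(x)`. -/

noncomputable section

namespace CoordCurv

variable {ι : Type} [Fintype ι] [DecidableEq ι]

/-- The partial derivative `∂_i f` at the point `x`. -/
def partialDeriv (i : ι) (f : (ι → ℝ) → ℝ) (x : ι → ℝ) : ℝ :=
  deriv (fun s : ℝ => f (Function.update x i s)) (x i)

/-- The Christoffel symbols
`Γ_{ab}{}^c = ½ g^{cd} (∂_a g_{bd} + ∂_b g_{ad} - ∂_d g_{ab})`. -/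
def christoffel (g : (ι → ℝ) → Matrix ι ι ℝ) (a b c : ι) (x : ι → ℝ) : ℝ :=
  (1 / 2) * ∑ d : ι, (g x)⁻¹ c d *
    (partialDeriv a (fun y => g y b d) x + partialDeriv b (fun y => g y a d) x
      - partialDeriv d (fun y => g y a b) x)

/-- The Riemann tensor
`R_{abc}{}^d = -2 ∂_{[a} Γ_{b]c}{}^d + 2 Γ_{c[a}{}^e Γ_{b]e}{}^d`. -/
def riemannUp (g : (ι → ℝ) → Matrix ι ι ℝ) (x : ι → ℝ) (a b c d : ι) : ℝ :=
  -(partialDeriv a (christoffel g b c d) x - partialDeriv b (christoffel g a c d) x)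
    + ∑ e : ι, (christoffel g c a e x * christoffel g b e d x
        - christoffel g c b e x * christoffel g a e d x)

/-- The Riemann tensor with all indices down, `R_{abcd} = R_{abc}{}^e g_{ed}`. -/
def riemann (g : (ι → ℝ) → Matrix ι ι ℝ) (x : ι → ℝ) (a b c d : ι) : ℝ :=
  ∑ e : ι, riemannUp g x a b c e * g x e d

/-- The Ricci tensor `R_{ab} = R_{adb}{}^d`. -/
def ricci (g : (ι → ℝ) → Matrix ι ι ℝ) (x : ι → ℝ) (a b : ι) : ℝ :=
  ∑ d : ι, riemannUp g x a d b d

/-- The Ricci scalar `R = g^{ab} R_{ab}`. -/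
def scalarCurv (g : (ι → ℝ) → Matrix ι ι ℝ) (x : ι → ℝ) : ℝ :=
  ∑ a : ι, ∑ b : ι, (g x)⁻¹ a b * ricci g x a b

/-- The Weyl tensor
`W_{abcd} = R_{abcd} + 2/(D-2) (g_{b[c} R_{d]a} - g_{a[c} R_{d]b})
  + 2/((D-1)(D-2)) R g_{c[a} g_{b]d}`, where `D` is the dimension. -/
def weyl (g : (ι → ℝ) → Matrix ι ι ℝ) (x : ι → ℝ) (a b c d : ι) : ℝ :=
  riemann g x a b c d
    + 1 / ((Fintype.card ι : ℝ) - 2) *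
      ((g x b c * ricci g x d a - g x b d * ricci g x c a)
        - (g x a c * ricci g x d b - g x a d * ricci g x c b))
    + 1 / (((Fintype.card ι : ℝ) - 1) * ((Fintype.card ι : ℝ) - 2)) * scalarCurv g x *
      (g x c a * g x b d - g x c b * g x a d)

/-- The traceless Ricci tensor `Z_{ac} = R_{ac} - (1/D) g_{ac} R`. -/
def tracelessRicci (g : (ι → ℝ) → Matrix ι ι ℝ) (x : ι → ℝ) (a c : ι) : ℝ :=
  ricci g x a c - 1 / (Fintype.card ι : ℝ) * g x a c * scalarCurv g x

/-- The traceless Ricci tensor with its second index raised, `Z_a{}^b = Z_{ac} g^{cb}`. -/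
def tracelessRicciUp (g : (ι → ℝ) → Matrix ι ι ℝ) (x : ι → ℝ) (a b : ι) : ℝ :=
  ∑ c : ι, tracelessRicci g x a c * (g x)⁻¹ c b

/-! ### Complete contractions -/

/-- The index slots of a product of `p` Weyl tensors (four slots each) and `q` traceless Ricci
tensors (two slots each). -/
abbrev Slot (p q : ℕ) : Type := (Fin p × Fin 4) ⊕ (Fin q × Fin 2)

/-- A way of contracting all indices of a product of `p` Weyl tensors and `q` traceless Ricci
tensors: an arrangement of the `4 p + 2 q` slots into `2 p + q` pairs. The `j`-th pair consists of
the images of `(j, 0)` and `(j, 1)`. -/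
abbrev Contraction (p q : ℕ) : Type := (Fin (2 * p + q) × Fin 2) ≃ Slot p q

/-- The curvature invariant `(R^m W^p Z^q)_σ` at the point `x`: the product of `m` Ricci scalars
with the complete contraction, prescribed by `σ`, of `p` Weyl tensors and `q` traceless Ricci
tensors. All tensors have their indices down, each pair of slots is contracted with the inverse
metric, and the sum runs over all assignments `f` of coordinate indices to slots. -/
def invariant (g : (ι → ℝ) → Matrix ι ι ℝ) (m : ℕ) {p q : ℕ} (σ : Contraction p q)
    (x : ι → ℝ) : ℝ :=
  scalarCurv g x ^ m *
    ∑ f : Slot p q → ι,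
      (∏ i : Fin p, weyl g x (f (Sum.inl (i, 0))) (f (Sum.inl (i, 1)))
        (f (Sum.inl (i, 2))) (f (Sum.inl (i, 3))))
      * (∏ i : Fin q, tracelessRicci g x (f (Sum.inr (i, 0))) (f (Sum.inr (i, 1))))
      * ∏ j : Fin (2 * p + q), (g x)⁻¹ (f (σ (j, 0))) (f (σ (j, 1)))

end CoordCurv

/-! ### FLRW backgrounds -/

/-- The data of an FLRW ansatz: the curvature parameter `k ∈ {-1, 0, 1}`, the scale factor `a(t)` and
the function `F(t)`, defined for `t` in an open set, where they are of class `C²`, with `F` positive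
and `a` nowhere zero (so that the metric is Lorentzian). -/
structure FLRW where
  k : ℝ
  a : ℝ → ℝ
  F : ℝ → ℝ
  times : Set ℝ
  k_eq : k = -1 ∨ k = 0 ∨ k = 1
  times_open : IsOpen times
  a_contDiff : ContDiffOn ℝ 2 a times
  F_contDiff : ContDiffOn ℝ 2 F times
  a_ne : ∀ t ∈ times, a t ≠ 0
  F_pos : ∀ t ∈ times, 0 < F t

namespace FLRW

/-- The FLRW metric
`-F(t) dt² + a(t)²/(1 - k r²) dr² + a(t)² r² dΩ²_n` in dimension `D = n + 2`. The coordinates are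
`t` (index `0`), `r` (index `1`) and stereographic coordinates `y` on the unit sphere `Sⁿ` (the
other `n` indices), in which the round metric is `dΩ²_n = 4 |dy|² / (1 + |y|²)²`. -/
def metric (B : FLRW) (n : ℕ) (x : Fin (n + 2) → ℝ) : Matrix (Fin (n + 2)) (Fin (n + 2)) ℝ :=
  Matrix.diagonal
    (Fin.cons (-B.F (x 0))
      (Fin.cons (B.a (x 0) ^ 2 / (1 - B.k * x 1 ^ 2))
        (fun _ : Fin n =>
          B.a (x 0) ^ 2 * x 1 ^ 2 * (4 / (1 + ∑ i : Fin n, x i.succ.succ ^ 2) ^ 2))))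

/-- The coordinate domain of the FLRW metric: `t` is an admissible time, `r > 0` and `k r² < 1`. -/
def domain (B : FLRW) (n : ℕ) : Set (Fin (n + 2) → ℝ) :=
  {x | x 0 ∈ B.times ∧ 0 < x 1 ∧ B.k * x 1 ^ 2 < 1}

/-- `Σ = (D-1) ((D-2) k F² + (D-2) F ȧ² - a ȧ Ḟ + 2 a ä F) / (a² F²)`. -/
def Sig (B : FLRW) (D : ℕ) (t : ℝ) : ℝ :=
  ((D : ℝ) - 1) *
    (((D : ℝ) - 2) * B.k * B.F t ^ 2 + ((D : ℝ) - 2) * B.F t * deriv B.a t ^ 2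
      - B.a t * deriv B.a t * deriv B.F t + 2 * B.a t * deriv (deriv B.a) t * B.F t)
    / (B.a t ^ 2 * B.F t ^ 2)

/-- `Γ = (D-2) (2 k F² + 2 F ȧ² + a ȧ Ḟ - 2 a ä F) / (2 a² F² D)`. -/
def Gam (B : FLRW) (D : ℕ) (t : ℝ) : ℝ :=
  ((D : ℝ) - 2) *
    (2 * B.k * B.F t ^ 2 + 2 * B.F t * deriv B.a t ^ 2
      + B.a t * deriv B.a t * deriv B.F t - 2 * B.a t * deriv (deriv B.a) t * B.F t)
    / (2 * B.a t ^ 2 * B.F t ^ 2 * (D : ℝ))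

end FLRW

end

/-! A Robertson–Walker metric is a warped product over the time axis with a fibre of constant
curvature `k`; that fibre is itself a warped product over the radial axis with a round sphere, and
the sphere is conformally flat in stereographic coordinates. Hence the Riemann tensor is diagonal on
coordinate planes, with only two sectional curvatures: one for the planes containing the time axis
and one for those tangent to the fibre. Such a curvature tensor has no Weyl part, and its traceless
Ricci endomorphism is a function `Γ` times a fixed diagonal matrix.

In a contraction of traceless Ricci tensors only the index assignments survive for which both
indices of every factor and both indices of every contracted pair agree. Each index value then
occurs equally often among the factors and among the contracted pairs, so all entries of the
metric cancel against those of its inverse, and what is left is a combinatorial constant times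
`Γ ^ q`. -/

noncomputable section

open Filter Topology Matrix

local notation "δ" => (1 : Matrix _ _ ℝ)

namespace CoordCurv

section General

variable {ι : Type} [DecidableEq ι] {x : ι → ℝ}

/-- `f'` is the partial derivative `∂_i f` at `x`, which exists. -/
def HasPartialDerivAt (i : ι) (f : (ι → ℝ) → ℝ) (f' : ℝ) (x : ι → ℝ) : Prop :=
  HasDerivAt (fun s : ℝ => f (Function.update x i s)) f' (x i)

theorem HasPartialDerivAt.partialDeriv_eq {i : ι} {f : (ι → ℝ) → ℝ} {f' : ℝ}
    (hf : HasPartialDerivAt i f f' x) : partialDeriv i f x = f' :=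
  hf.deriv

theorem partialDeriv_congr {f₁ f₂ : (ι → ℝ) → ℝ} (hf : f₁ =ᶠ[𝓝 x] f₂) (i : ι) :
    partialDeriv i f₁ x = partialDeriv i f₂ x := by
  have hupdate : Tendsto (fun s : ℝ => Function.update x i s) (𝓝 (x i)) (𝓝 x) := by
    have : Continuous fun s : ℝ => Function.update x i s := by fun_prop
    simpa using this.tendsto (x i)
  exact (hf.comp_tendsto hupdate).deriv_eq

theorem partialDeriv_const (i : ι) (c : ℝ) : partialDeriv i (fun _ => c) x = 0 :=
  deriv_const _ _

theorem partialDeriv_const_mul (i : ι) (c : ℝ) (f : (ι → ℝ) → ℝ) :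
    partialDeriv i (fun y => c * f y) x = c * partialDeriv i f x :=
  deriv_const_mul_field c

variable [Fintype ι] {g : (ι → ℝ) → Matrix ι ι ℝ}

/-- Near `x` the matrices `g y` are symmetric and invertible, so that `g` is a pseudo-Riemannian
metric there, of arbitrary signature; its smoothness is not part of the notion. -/
def IsMetricNear (g : (ι → ℝ) → Matrix ι ι ℝ) (x : ι → ℝ) : Prop :=
  ∀ᶠ y in 𝓝 x, (g y).IsSymm ∧ IsUnit (g y).det

theorem partialDeriv_metric_comm (hg : IsMetricNear g x) (a b c : ι) :
    partialDeriv a (fun y => g y b c) x = partialDeriv a (fun y => g y c b) x :=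
  partialDeriv_congr (hg.mono fun _ hy => hy.1.apply c b) a

theorem christoffel_comm (hg : IsMetricNear g x) (a b c : ι) :
    christoffel g a b c x = christoffel g b a c x := by
  simp only [christoffel, partialDeriv_metric_comm hg _ a b, add_comm]

theorem partialDeriv_christoffel_comm (hg : IsMetricNear g x) (e a b c : ι) :
    partialDeriv e (christoffel g a b c) x = partialDeriv e (christoffel g b a c) x :=
  partialDeriv_congr
    ((eventually_eventually_nhds.2 hg).mono fun _ hy => christoffel_comm hy a b c) e

theorem sum_christoffel_mul (hg : IsUnit (g x).det) (a b c : ι) :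
    ∑ l, christoffel g a b l x * g x c l
      = (1 / 2) * (partialDeriv a (fun y => g y b c) x + partialDeriv b (fun y => g y a c) x
          - partialDeriv c (fun y => g y a b) x) := by
  have hinv := Matrix.mul_nonsing_inv (g x) hg
  set v : ι → ℝ := fun d => partialDeriv a (fun y => g y b d) x
    + partialDeriv b (fun y => g y a d) x - partialDeriv d (fun y => g y a b) x
  have hΓ : (fun l => christoffel g a b l x) = (1 / 2 : ℝ) • ((g x)⁻¹ *ᵥ v) := rfl
  calc ∑ l, christoffel g a b l x * g x c l
      = (g x *ᵥ fun l => christoffel g a b l x) c := by simp only [mulVec, dotProduct, mul_comm]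
    _ = (1 / 2) * v c := by
      rw [hΓ, mulVec_smul, mulVec_mulVec, hinv, one_mulVec, Pi.smul_apply, smul_eq_mul]

theorem riemannUp_swap (a b c d : ι) : riemannUp g x b a c d = -riemannUp g x a b c d := by
  simp only [riemannUp, Finset.sum_sub_distrib]
  ring

theorem riemannUp_self (a c d : ι) : riemannUp g x a a c d = 0 := by
  simp only [riemannUp, sub_self, Finset.sum_const_zero, neg_zero, add_zero]

/-- The Riemann tensor of the metric `g` at `x` is
`R_{abc}{}^d = κ_{ab} (g_{ac} δ_b^d - g_{bc} δ_a^d)`, so that `κ_{ab}` is the sectional curvature of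
the coordinate plane of `a ≠ b`; the diagonal values `κ_{aa}` are irrelevant. If all the `κ_{ab}`
agree, the curvature is isotropic at `x`. -/
structure HasSectionalCurvAt (g : (ι → ℝ) → Matrix ι ι ℝ) (x : ι → ℝ) (κ : ι → ι → ℝ) : Prop where
  isMetricNear : IsMetricNear g x
  riemannUp_eq : ∀ a b c d, riemannUp g x a b c d
    = κ a b * (g x a c * δ b d - g x b c * δ a d)

/-- The factor `∑_{d ≠ a} κ_{ad}` of the Ricci tensor `R_{ab}` of a metric with sectional
curvatures `κ`. -/
def ricciFactor (κ : ι → ι → ℝ) (a : ι) : ℝ := ∑ d, κ a d - κ a a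

namespace HasSectionalCurvAt

variable {κ : ι → ι → ℝ}

theorem isSymm (hg : HasSectionalCurvAt g x κ) : (g x).IsSymm :=
  hg.isMetricNear.self_of_nhds.1

theorem isUnit_det (hg : HasSectionalCurvAt g x κ) : IsUnit (g x).det :=
  hg.isMetricNear.self_of_nhds.2

theorem ricci_eq (hg : HasSectionalCurvAt g x κ) (a b : ι) :
    ricci g x a b = ricciFactor κ a * g x a b := by
  simp only [ricci, hg.riemannUp_eq, mul_one, mul_sub, one_apply, mul_ite, mul_zero,
    Finset.sum_sub_distrib, Finset.sum_ite_eq, Finset.mem_univ, if_true, ← Finset.sum_mul,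
    ricciFactor, sub_mul]

theorem riemann_eq (hg : HasSectionalCurvAt g x κ) (a b c d : ι) :
    riemann g x a b c d = κ a b * (g x a c * g x b d - g x b c * g x a d) := by
  simp only [riemann, hg.riemannUp_eq, one_apply, mul_ite, mul_one, mul_zero, mul_sub, sub_mul,
    ite_mul, zero_mul, Finset.sum_sub_distrib, Finset.sum_ite_eq, Finset.mem_univ, if_true,
    mul_assoc]

theorem scalarCurv_eq (hg : HasSectionalCurvAt g x κ) :
    scalarCurv g x = ∑ a, ricciFactor κ a := by
  have htrace (a : ι) : ∑ b, (g x)⁻¹ a b * g x a b = 1 := by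
    have := congrFun₂ (Matrix.nonsing_inv_mul (g x) hg.isUnit_det) a a
    simpa only [mul_apply, hg.isSymm.apply, one_apply_eq] using this
  simp only [scalarCurv, hg.ricci_eq, mul_left_comm _ (ricciFactor κ _), ← Finset.mul_sum, htrace,
    mul_one]

theorem tracelessRicci_eq (hg : HasSectionalCurvAt g x κ) (a b : ι) :
    tracelessRicci g x a b = (ricciFactor κ a - scalarCurv g x / Fintype.card ι) * g x a b := by
  rw [tracelessRicci, hg.ricci_eq]
  ring

theorem tracelessRicciUp_eq (hg : HasSectionalCurvAt g x κ) (a b : ι) :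
    tracelessRicciUp g x a b
      = (ricciFactor κ a - scalarCurv g x / Fintype.card ι) * δ a b := by
  simp only [tracelessRicciUp, hg.tracelessRicci_eq, mul_assoc, ← Finset.mul_sum]
  rw [← Matrix.mul_nonsing_inv (g x) hg.isUnit_det, mul_apply]

theorem weyl_eq_zero (hg : HasSectionalCurvAt g x κ)
    (hricci : ∀ a b, ricciFactor κ a * g x a b = ricciFactor κ b * g x a b)
    (hκ : ∀ a b, a ≠ b → κ a b
      = 1 / ((Fintype.card ι : ℝ) - 2) * (ricciFactor κ a + ricciFactor κ b)
        - 1 / (((Fintype.card ι : ℝ) - 1) * ((Fintype.card ι : ℝ) - 2)) * scalarCurv g x)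
    (a b c d : ι) : weyl g x a b c d = 0 := by
  rw [weyl, hg.riemann_eq]
  simp only [hg.ricci_eq]
  rw [hricci d a, hricci c a, hricci d b, hricci c b, hg.isSymm.apply a d, hg.isSymm.apply a c,
    hg.isSymm.apply b d, hg.isSymm.apply b c]
  obtain rfl | hab := eq_or_ne a b
  · ring
  · rw [hκ a b hab]
    ring

end HasSectionalCurvAt

end General

section AxiallyIsotropic

variable {ι : Type} [DecidableEq ι]

/-- The sectional curvature which is `H` on the coordinate planes that contain the axis `i`, and `K`
on the others. -/
def axialCurv (i : ι) (H K : ℝ) (a b : ι) : ℝ := if a = i ∨ b = i then H else K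

theorem axialCurv_self (i : ι) (K : ℝ) : axialCurv i K K = fun _ _ => K := by
  ext a b
  exact ite_self K

variable [Fintype ι] {g : (ι → ℝ) → Matrix ι ι ℝ} {x : ι → ℝ} {i : ι} {H K : ℝ}

/-- At `x` the coordinate axes are orthogonal, and the sectional curvature distinguishes only
between the planes which contain the axis `i` and those orthogonal to it. -/
structure IsAxiallyIsotropicAt (g : (ι → ℝ) → Matrix ι ι ℝ) (x : ι → ℝ) (i : ι) (H K : ℝ) :
    Prop where
  isDiag : (g x).IsDiag
  hasSectionalCurvAt : HasSectionalCurvAt g x (axialCurv i H K)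

/-- The eigenvalues of the trace-free endomorphism which is `1` on the orthogonal complement of the
axis `i`. -/
def axialEigenvalue (i a : ι) : ℝ := 1 - if a = i then (Fintype.card ι : ℝ) else 0

theorem sum_ite_eq_axis (i : ι) (u v : ℝ) :
    ∑ d, (if d = i then u else v) = u + ((Fintype.card ι : ℝ) - 1) * v := by
  rw [← Finset.add_sum_erase _ _ (Finset.mem_univ i), if_pos rfl, Finset.sum_congr rfl
    fun d hd => if_neg (Finset.ne_of_mem_erase hd), Finset.sum_const, nsmul_eq_mul,
    Finset.cast_card_erase_of_mem (Finset.mem_univ i), Finset.card_univ]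

theorem ricciFactor_axialCurv (i : ι) (H K : ℝ) (a : ι) :
    ricciFactor (axialCurv i H K) a
      = if a = i then ((Fintype.card ι : ℝ) - 1) * H
        else H + ((Fintype.card ι : ℝ) - 2) * K := by
  obtain rfl | ha := eq_or_ne a i
  · simp only [ricciFactor, axialCurv, true_or, if_true, Finset.sum_const,
      Finset.card_univ, nsmul_eq_mul]
    ring
  · simp only [ricciFactor, axialCurv, ha, false_or, or_self, if_false, sum_ite_eq_axis]
    ring

namespace IsAxiallyIsotropicAt

theorem scalarCurv_eq (hg : IsAxiallyIsotropicAt g x i H K) :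
    scalarCurv g x
      = ((Fintype.card ι : ℝ) - 1) * (2 * H + ((Fintype.card ι : ℝ) - 2) * K) := by
  simp only [hg.hasSectionalCurvAt.scalarCurv_eq, ricciFactor_axialCurv, sum_ite_eq_axis]
  ring

theorem ricciFactor_sub_eq (hg : IsAxiallyIsotropicAt g x i H K) (a : ι) :
    ricciFactor (axialCurv i H K) a - scalarCurv g x / Fintype.card ι
      = ((Fintype.card ι : ℝ) - 2) * (K - H) / Fintype.card ι * axialEigenvalue i a := by
  have hD : (Fintype.card ι : ℝ) ≠ 0 := Nat.cast_ne_zero.2 (Fintype.card_pos_iff.2 ⟨i⟩).ne'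
  rw [ricciFactor_axialCurv, hg.scalarCurv_eq, axialEigenvalue]
  split_ifs <;> field_simp <;> ring

theorem tracelessRicci_eq (hg : IsAxiallyIsotropicAt g x i H K) (a b : ι) :
    tracelessRicci g x a b
      = ((Fintype.card ι : ℝ) - 2) * (K - H) / Fintype.card ι * axialEigenvalue i a * g x a b := by
  rw [hg.hasSectionalCurvAt.tracelessRicci_eq, hg.ricciFactor_sub_eq]

theorem tracelessRicciUp_eq (hg : IsAxiallyIsotropicAt g x i H K) (a b : ι) :
    tracelessRicciUp g x a b
      = ((Fintype.card ι : ℝ) - 2) * (K - H) / Fintype.card ι * axialEigenvalue i a * δ a b := by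
  rw [hg.hasSectionalCurvAt.tracelessRicciUp_eq, hg.ricciFactor_sub_eq]

theorem weyl_eq_zero (hg : IsAxiallyIsotropicAt g x i H K) (hD : 3 ≤ Fintype.card ι)
    (a b c d : ι) : weyl g x a b c d = 0 := by
  have hD' : (3 : ℝ) ≤ Fintype.card ι := by exact_mod_cast hD
  have hD₁ : (Fintype.card ι : ℝ) - 1 ≠ 0 := by linarith
  have hD₂ : (Fintype.card ι : ℝ) - 2 ≠ 0 := by linarith
  refine hg.hasSectionalCurvAt.weyl_eq_zero (fun a b => ?_) (fun a b hab => ?_) a b c d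
  · obtain rfl | hab := eq_or_ne a b
    · rfl
    · rw [hg.isDiag hab, mul_zero, mul_zero]
  · rw [ricciFactor_axialCurv, ricciFactor_axialCurv, hg.scalarCurv_eq, axialCurv]
    obtain rfl | ha := eq_or_ne a i
    · simp only [true_or, if_true, hab.symm, if_false]
      field_simp
      ring
    · simp only [ha, false_or, if_false]
      split_ifs <;> field_simp <;> ring

end IsAxiallyIsotropicAt

end AxiallyIsotropic

section Pairings

variable {ι β γ : Type*} [Fintype β] [Fintype γ]

theorem card_fiber_of_pairs_eq [DecidableEq ι] {u : β × Fin 2 → ι}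
    (hu : ∀ i, u (i, 0) = u (i, 1)) (a : ι) :
    Fintype.card {s // a = u s} = 2 * Fintype.card {i // a = u (i, 0)} := by
  simp only [Fintype.card_subtype, Finset.card_filter, Fintype.sum_prod_type, Fin.sum_univ_two,
    ← hu, ← two_mul, Finset.mul_sum]

/-- Each value occurs in the slots twice as often as among the first members of the pairs, for
either way of arranging the slots in pairs. -/
theorem prod_eq_prod_of_pairs_eq {M : Type*} [CommMonoid M] (e : γ × Fin 2 ≃ β × Fin 2)
    {u : β × Fin 2 → ι} (hβ : ∀ i, u (i, 0) = u (i, 1))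
    (hγ : ∀ j, u (e (j, 0)) = u (e (j, 1))) (v : ι → M) :
    ∏ i, v (u (i, 0)) = ∏ j, v (u (e (j, 0))) := by
  classical
  have hvalues : Finset.univ.val.map (fun i => u (i, 0))
      = Finset.univ.val.map fun j => u (e (j, 0)) := by
    ext a
    have hslots : Fintype.card {s // a = u (e s)} = Fintype.card {s // a = u s} :=
      Fintype.card_congr (e.subtypeEquiv fun _ => Iff.rfl)
    rw [card_fiber_of_pairs_eq hβ, card_fiber_of_pairs_eq (u := fun s => u (e s)) hγ,
      Fintype.card_subtype, Fintype.card_subtype] at hslots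
    rw [Multiset.count_map, Multiset.count_map]
    exact (Nat.eq_of_mul_eq_mul_left two_pos hslots).symm
  have hprod := congrArg (fun s => (s.map v).prod) hvalues
  simp only [Multiset.map_map] at hprod
  exact hprod

end Pairings

section Contractions

variable {ι : Type} {q : ℕ}

theorem prod_pairs_eq_of_contraction {M : Type*} [CommMonoid M]
    (σ : Contraction 0 q) {f : Slot 0 q → ι}
    (hf : ∀ i, f (Sum.inr (i, 0)) = f (Sum.inr (i, 1)))
    (hσ : ∀ j, f (σ (j, 0)) = f (σ (j, 1))) (v : ι → M) :
    ∏ i, v (f (Sum.inr (i, 0))) = ∏ j, v (f (σ (j, 0))) := by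
  have hinr (s : Slot 0 q) : Sum.inr (Equiv.emptySum (Fin 0 × Fin 4) (Fin q × Fin 2) s) = s :=
    (Equiv.emptySum _ _).symm_apply_apply s
  simpa only [Function.comp_apply, Equiv.trans_apply, hinr] using
    prod_eq_prod_of_pairs_eq (σ.trans (Equiv.emptySum _ _)) (u := f ∘ Sum.inr) hf
      (by simpa only [Function.comp_apply, Equiv.trans_apply, hinr] using hσ) v

open scoped Classical in
/-- The value of the contraction `σ` of `q` copies of the endomorphism `diag ζ`: only the index
assignments for which the two slots of each factor, and the two slots of each pair of `σ`, carry
the same index contribute. -/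
def diagonalContraction [Fintype ι] (ζ : ι → ℝ) (σ : Contraction 0 q) : ℝ :=
  ∑ f : Slot 0 q → ι, if (∀ i, f (Sum.inr (i, 0)) = f (Sum.inr (i, 1))) ∧
    ∀ j, f (σ (j, 0)) = f (σ (j, 1)) then ∏ i, ζ (f (Sum.inr (i, 0))) else 0

variable [Fintype ι] [DecidableEq ι] {g : (ι → ℝ) → Matrix ι ι ℝ} {x : ι → ℝ}

theorem invariant_eq_diagonalContraction (hdiag : (g x).IsDiag) (hdet : IsUnit (g x).det)
    {ζ : ι → ℝ} {γ : ℝ} (hZ : ∀ a b, tracelessRicci g x a b = γ * ζ a * g x a b) (m : ℕ)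
    (σ : Contraction 0 q) :
    invariant g m σ x = diagonalContraction ζ σ * scalarCurv g x ^ m * γ ^ q := by
  obtain ⟨d, hg⟩ : ∃ d, g x = diagonal d := ⟨_, hdiag.diagonal_diag.symm⟩
  have hd (a : ι) : d a ≠ 0 := by
    rw [hg, det_diagonal, isUnit_iff_ne_zero, Finset.prod_ne_zero_iff] at hdet
    exact hdet a (Finset.mem_univ a)
  have hinv : (diagonal d)⁻¹ = diagonal fun a => (d a)⁻¹ := by
    refine inv_eq_right_inv ?_
    simp only [diagonal_mul_diagonal, mul_inv_cancel₀ (hd _), diagonal_one]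
  rw [invariant, diagonalContraction, mul_right_comm, mul_comm]
  congr 1
  rw [Finset.sum_mul]
  refine Finset.sum_congr rfl fun f _ => ?_
  simp only [hZ, hg, hinv, diagonal_apply, mul_ite, mul_zero, Finset.prod_ite_zero, Finset.mem_univ,
    true_implies, Finset.univ_eq_empty, Finset.prod_empty, one_mul, ite_and, ite_mul, zero_mul]
  split_ifs with hσ hf
  · have hcancel : (∏ i, d (f (Sum.inr (i, 0)))) * ∏ j, (d (f (σ (j, 0))))⁻¹ = 1 := by
      rw [prod_pairs_eq_of_contraction σ hf hσ, ← Finset.prod_mul_distrib]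
      exact Finset.prod_eq_one fun j _ => mul_inv_cancel₀ (hd _)
    rw [Finset.prod_mul_distrib, mul_assoc, hcancel, Finset.prod_mul_distrib, Finset.prod_const,
      Finset.card_univ, Fintype.card_fin]
    ring
  all_goals rfl

theorem invariant_eq_zero (hW : ∀ a b c d, weyl g x a b c d = 0) (m : ℕ) {p : ℕ}
    (σ : Contraction p q) (hp : 1 ≤ p) : invariant g m σ x = 0 := by
  simp only [invariant, hW, Finset.prod_const, Finset.card_univ, Fintype.card_fin,
    zero_pow (Nat.one_le_iff_ne_zero.1 hp), zero_mul, Finset.sum_const_zero, mul_zero]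

end Contractions

section ConformallyFlat

variable {ι : Type} [DecidableEq ι] {ρ : (ι → ℝ) → ℝ} {dρ : ι → (ι → ℝ) → ℝ} {x : ι → ℝ}

/-- The conformally flat metric `ρ⁻² ∑ (dx^a)²`. -/
def conformalMetric (ρ : (ι → ℝ) → ℝ) (x : ι → ℝ) : Matrix ι ι ℝ :=
  diagonal fun _ => (ρ x ^ 2)⁻¹

theorem partialDeriv_conformalMetric {a : ι} (hρ : ρ x ≠ 0)
    (hdρ : HasPartialDerivAt a ρ (dρ a x) x) (b c : ι) :
    partialDeriv a (fun y => conformalMetric ρ y b c) x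
      = -2 * dρ a x / ρ x ^ 3 * δ b c := by
  have hderiv : HasPartialDerivAt a (fun y => (ρ y ^ 2)⁻¹) (-2 * dρ a x / ρ x ^ 3) x := by
    refine (HasDerivAt.fun_inv (HasDerivAt.fun_pow hdρ 2) (by simpa using hρ)).congr_deriv ?_
    simp only [Function.update_eq_self, Nat.cast_ofNat, Nat.reduceSub, pow_one]
    field_simp
  obtain rfl | hbc := eq_or_ne b c
  · simpa only [conformalMetric, diagonal_apply_eq, one_apply_eq, mul_one]
      using hderiv.partialDeriv_eq
  · simp only [conformalMetric, diagonal_apply_ne _ hbc, one_apply_ne hbc, mul_zero,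
      partialDeriv_const]

/-- `δ_{ab} ∂_c ρ - δ_{bc} ∂_a ρ - δ_{ac} ∂_b ρ`, which is `ρ` times the Christoffel symbol
`Γ_{ab}{}^c` of `conformalMetric ρ`; the argument `v` is the gradient of `ρ`. -/
def conformalSymbol (v : ι → ℝ) (a b c : ι) : ℝ :=
  δ a b * v c - δ b c * v a - δ a c * v b

variable [Fintype ι]

theorem christoffel_conformalMetric (hρ : ρ x ≠ 0)
    (hdρ : ∀ a, HasPartialDerivAt a ρ (dρ a x) x) (a b c : ι) :
    christoffel (conformalMetric ρ) a b c x = conformalSymbol (fun e => dρ e x) a b c / ρ x := by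
  have hinv : (conformalMetric ρ x)⁻¹ = diagonal fun _ => ρ x ^ 2 := by
    refine Matrix.inv_eq_right_inv ?_
    rw [conformalMetric, diagonal_mul_diagonal, inv_mul_cancel₀ (pow_ne_zero 2 hρ), diagonal_one]
  simp only [christoffel, partialDeriv_conformalMetric hρ (hdρ _), hinv, diagonal_apply, ite_mul,
    zero_mul, Finset.sum_ite_eq, Finset.mem_univ, if_true, conformalSymbol]
  field_simp
  ring

theorem sum_conformalSymbol_mul (v : ι → ℝ) (a b c d : ι) :
    ∑ e, conformalSymbol v c a e * conformalSymbol v b e d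
      = δ a d * v b * v c + 2 * δ b d * v a * v c
        + δ c d * v a * v b - δ a b * v c * v d
        - δ b c * v a * v d
        - δ a c * δ b d * ∑ e, v e ^ 2 := by
  have hδ (i : ι) (w : ι → ℝ) : ∑ e, δ i e * w e = w i :=
    congrFun (one_mulVec w) i
  have hexpand (e : ι) : conformalSymbol v c a e * conformalSymbol v b e d
      = δ b e * (δ a c * v e * v d)
        - δ d e * (δ a c * v e * v b)
        - δ a e * (v c * conformalSymbol v b e d)
        - δ c e * (v a * conformalSymbol v b e d)
        - δ a c * δ b d * v e ^ 2 := by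
    have hde : δ e d = δ d e := isSymm_one.apply _ _
    have hca : δ c a = δ a c := isSymm_one.apply _ _
    simp only [conformalSymbol, hde, hca]
    ring
  simp only [hexpand, Finset.sum_sub_distrib, hδ, ← Finset.mul_sum]
  simp only [conformalSymbol, isSymm_one.apply a b]
  ring

theorem partialDeriv_christoffel_conformalMetric {l : ℝ}
    (hρ : ∀ᶠ y in 𝓝 x, ρ y ≠ 0) (hdρ : ∀ᶠ y in 𝓝 x, ∀ a, HasPartialDerivAt a ρ (dρ a y) y)
    (hddρ : ∀ a b, HasPartialDerivAt b (dρ a) (l * δ a b) x) (a b c d : ι) :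
    partialDeriv a (christoffel (conformalMetric ρ) b c d) x
      = l * conformalSymbol (δ a) b c d / ρ x
        - dρ a x * conformalSymbol (fun e => dρ e x) b c d / ρ x ^ 2 := by
  have hΓ : christoffel (conformalMetric ρ) b c d
      =ᶠ[𝓝 x] fun y => conformalSymbol (fun e => dρ e y) b c d / ρ y := by
    filter_upwards [hρ, hdρ] with y hy hdy using christoffel_conformalMetric hy hdy b c d
  rw [partialDeriv_congr hΓ]
  refine HasPartialDerivAt.partialDeriv_eq (HasDerivAt.congr_deriv (HasDerivAt.div
    ((((hddρ d a).const_mul _).sub ((hddρ b a).const_mul _)).sub ((hddρ c a).const_mul _))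
    (hdρ.self_of_nhds a) (by simpa only [Function.update_eq_self] using hρ.self_of_nhds)) ?_)
  have := hρ.self_of_nhds
  have hδ (i : ι) : δ i a = δ a i := isSymm_one.apply _ _
  simp only [Function.update_eq_self, conformalSymbol, hδ]
  field_simp

/-- With `u = -log ρ` the curvature of `e^{2u} ∑ (dx^a)²` depends on `∂_a ∂_b u - ∂_a u ∂_b u`,
which is `-∂_a ∂_b ρ / ρ`; this is why a multiple of the identity as Hessian of `ρ` suffices. -/
theorem hasSectionalCurvAt_conformalMetric {l : ℝ}
    (hρ : ∀ᶠ y in 𝓝 x, ρ y ≠ 0) (hdρ : ∀ᶠ y in 𝓝 x, ∀ a, HasPartialDerivAt a ρ (dρ a y) y)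
    (hddρ : ∀ a b, HasPartialDerivAt b (dρ a) (l * δ a b) x) :
    HasSectionalCurvAt (conformalMetric ρ) x fun _ _ => 2 * l * ρ x - ∑ a, dρ a x ^ 2 where
  isMetricNear := by
    filter_upwards [hρ] with y hy
    refine ⟨isSymm_diagonal _, ?_⟩
    simp only [conformalMetric, det_diagonal, Finset.prod_const, isUnit_iff_ne_zero]
    exact pow_ne_zero _ (inv_ne_zero (pow_ne_zero 2 hy))
  riemannUp_eq a b c d := by
    have hρx := hρ.self_of_nhds
    have hΓ := christoffel_conformalMetric hρx hdρ.self_of_nhds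
    have hmetric (i j : ι) : conformalMetric ρ x i j = δ i j / ρ x ^ 2 := by
      simp only [conformalMetric, diagonal_apply, one_apply, ite_div, one_div, zero_div]
    simp only [riemannUp, partialDeriv_christoffel_conformalMetric hρ hdρ hddρ, hΓ,
      div_mul_div_comm, Finset.sum_sub_distrib, ← Finset.sum_div, sum_conformalSymbol_mul, hmetric]
    rw [isSymm_one.apply a b]
    simp only [conformalSymbol]
    rw [isSymm_one.apply a b]
    field_simp
    ring

end ConformallyFlat

section WarpedProduct

variable {n : ℕ} {G f : ℝ → ℝ} {h : (Fin n → ℝ) → Matrix (Fin n) (Fin n) ℝ} {x : Fin (n + 1) → ℝ}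

theorem partialDeriv_zero (φ : (Fin (n + 1) → ℝ) → ℝ) :
    partialDeriv 0 φ x = deriv (fun s => φ (Fin.cons s (Fin.tail x))) (x 0) := by
  have hupdate (s : ℝ) : Function.update x 0 s = Fin.cons s (Fin.tail x) := by
    rw [← Fin.update_cons_zero (x 0), Fin.cons_self_tail]
  simp only [partialDeriv, hupdate]

theorem partialDeriv_succ (i : Fin n) (φ : (Fin (n + 1) → ℝ) → ℝ) :
    partialDeriv i.succ φ x = partialDeriv i (fun y => φ (Fin.cons (x 0) y)) (Fin.tail x) := by
  simp only [partialDeriv, Fin.cons_update, Fin.cons_self_tail]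
  rfl

/-- The warped product metric `G(t) dt² + f(t)² ∑ h_{ij}(y) dy^i dy^j`, where `t` is the coordinate
with index `0` and `y` consists of the other coordinates. The sign of `G` is arbitrary. -/
def warpedMetric (G f : ℝ → ℝ) (h : (Fin n → ℝ) → Matrix (Fin n) (Fin n) ℝ) (x : Fin (n + 1) → ℝ) :
    Matrix (Fin (n + 1)) (Fin (n + 1)) ℝ :=
  of (Fin.cons (Fin.cons (G (x 0)) 0)
    fun i => Fin.cons 0 fun j => f (x 0) ^ 2 * h (Fin.tail x) i j)

@[simp]
theorem warpedMetric_zero_zero : warpedMetric G f h x 0 0 = G (x 0) :=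
  rfl

@[simp]
theorem warpedMetric_zero_succ (i : Fin n) : warpedMetric G f h x 0 i.succ = 0 :=
  rfl

@[simp]
theorem warpedMetric_succ_zero (i : Fin n) : warpedMetric G f h x i.succ 0 = 0 :=
  rfl

@[simp]
theorem warpedMetric_succ_succ (i j : Fin n) :
    warpedMetric G f h x i.succ j.succ = f (x 0) ^ 2 * h (Fin.tail x) i j :=
  rfl

theorem isDiag_warpedMetric (hh : (h (Fin.tail x)).IsDiag) : (warpedMetric G f h x).IsDiag := by
  intro a b hab
  cases a using Fin.cases <;> cases b using Fin.cases
  case zero.zero => exact absurd rfl hab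
  case succ.succ i j =>
    rw [warpedMetric_succ_succ, hh (ne_of_apply_ne Fin.succ hab), mul_zero]
  all_goals rfl

/-- At the single point `x`, the metric `warpedMetric G f h` has the properties from which its
Christoffel symbols follow. -/
structure WarpedProductAt (G f : ℝ → ℝ) (h : (Fin n → ℝ) → Matrix (Fin n) (Fin n) ℝ)
    (x : Fin (n + 1) → ℝ) : Prop where
  base_ne_zero : G (x 0) ≠ 0
  warping_ne_zero : f (x 0) ≠ 0
  differentiableAt_warping : DifferentiableAt ℝ f (x 0)
  fibre_isSymm : (h (Fin.tail x)).IsSymm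
  fibre_isUnit_det : IsUnit (h (Fin.tail x)).det

namespace WarpedProductAt

theorem isSymm (hx : WarpedProductAt G f h x) : (warpedMetric G f h x).IsSymm := by
  refine IsSymm.ext fun a b => ?_
  cases a using Fin.cases <;> cases b using Fin.cases <;>
    simp only [warpedMetric_zero_zero, warpedMetric_zero_succ, warpedMetric_succ_zero,
      warpedMetric_succ_succ, hx.fibre_isSymm.apply]

theorem mul_inv (hx : WarpedProductAt G f h x) :
    warpedMetric G f h x * warpedMetric G⁻¹ f⁻¹ (fun y => (h y)⁻¹) x = 1 := by
  have hG := hx.base_ne_zero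
  have hf := hx.warping_ne_zero
  ext a b
  cases a using Fin.cases <;> cases b using Fin.cases <;>
    simp only [mul_apply, Fin.sum_univ_succ, warpedMetric_zero_zero, warpedMetric_zero_succ,
      warpedMetric_succ_zero, warpedMetric_succ_succ, mul_zero, zero_mul, Finset.sum_const_zero,
      add_zero, zero_add, Pi.inv_apply, mul_inv_cancel₀ hG, one_apply_eq, one_apply_ne,
      ne_eq, Fin.succ_ne_zero, not_false_eq_true, (Fin.succ_ne_zero _).symm]
  case succ.succ i j =>
    have hfibre := congrFun₂ (mul_nonsing_inv _ hx.fibre_isUnit_det) i j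
    rw [mul_apply] at hfibre
    simp only [mul_mul_mul_comm _ (h _ _ _), ← mul_pow, mul_inv_cancel₀ hf, one_pow, one_mul,
      hfibre, one_apply, Fin.succ_inj]

theorem isUnit_det (hx : WarpedProductAt G f h x) : IsUnit (warpedMetric G f h x).det :=
  isUnit_det_of_right_inverse hx.mul_inv

theorem inv_eq (hx : WarpedProductAt G f h x) :
    (warpedMetric G f h x)⁻¹ = warpedMetric G⁻¹ f⁻¹ (fun y => (h y)⁻¹) x :=
  inv_eq_right_inv hx.mul_inv

theorem deriv_warping_sq (hx : WarpedProductAt G f h x) :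
    deriv (fun t => f t ^ 2) (x 0) = 2 * f (x 0) * deriv f (x 0) := by
  simp only [deriv_fun_pow hx.differentiableAt_warping, Nat.cast_ofNat, Nat.reduceSub, pow_one]

theorem christoffel_zero_zero_zero (hx : WarpedProductAt G f h x) :
    christoffel (warpedMetric G f h) 0 0 0 x = deriv G (x 0) / (2 * G (x 0)) := by
  simp only [christoffel, hx.inv_eq, Fin.sum_univ_succ, partialDeriv_zero, warpedMetric_zero_zero,
    warpedMetric_zero_succ, Pi.inv_apply, Fin.cons_zero, add_sub_cancel_right, zero_mul,
    Finset.sum_const_zero, add_zero]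
  field_simp

theorem christoffel_zero_zero_succ (hx : WarpedProductAt G f h x) (i : Fin n) :
    christoffel (warpedMetric G f h) 0 0 i.succ x = 0 := by
  simp [christoffel, hx.inv_eq, Fin.sum_univ_succ, partialDeriv_zero, partialDeriv_succ,
    partialDeriv_const]

theorem christoffel_zero_succ_zero (hx : WarpedProductAt G f h x) (i : Fin n) :
    christoffel (warpedMetric G f h) 0 i.succ 0 x = 0 := by
  simp [christoffel, hx.inv_eq, Fin.sum_univ_succ, partialDeriv_zero, partialDeriv_succ,
    partialDeriv_const]

theorem christoffel_zero_succ_succ (hx : WarpedProductAt G f h x) (i j : Fin n) :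
    christoffel (warpedMetric G f h) 0 i.succ j.succ x = deriv f (x 0) / f (x 0) * δ i j := by
  have hf := hx.warping_ne_zero
  have hfibre := congrFun₂ (nonsing_inv_mul _ hx.fibre_isUnit_det) j i
  rw [mul_apply, isSymm_one.apply i j] at hfibre
  simp only [christoffel, hx.inv_eq, Fin.sum_univ_succ, partialDeriv_zero, partialDeriv_succ,
    warpedMetric_zero_succ, warpedMetric_succ_zero, warpedMetric_succ_succ, partialDeriv_const,
    sub_zero, Fin.cons_zero, Fin.tail_cons, Pi.inv_apply, zero_mul, zero_add, add_zero,
    deriv_mul_const_field', hx.deriv_warping_sq, hx.fibre_isSymm.apply _ i, mul_mul_mul_comm _ _ (2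
    * f (x 0) * deriv f (x 0)), ← Finset.mul_sum, hfibre]
  field_simp

theorem christoffel_succ_succ_zero (hx : WarpedProductAt G f h x) (i j : Fin n) :
    christoffel (warpedMetric G f h) i.succ j.succ 0 x
      = -(f (x 0) * deriv f (x 0) / G (x 0)) * h (Fin.tail x) i j := by
  simp only [christoffel, hx.inv_eq, Fin.sum_univ_succ, partialDeriv_zero, partialDeriv_succ,
    warpedMetric_zero_zero, warpedMetric_zero_succ, warpedMetric_succ_zero, warpedMetric_succ_succ,
    partialDeriv_const, Pi.inv_apply, Fin.cons_zero, Fin.tail_cons, deriv_mul_const_field',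
    hx.deriv_warping_sq, zero_mul, Finset.sum_const_zero, add_zero, zero_sub]
  field_simp

theorem christoffel_succ_succ_succ (hx : WarpedProductAt G f h x) (i j k : Fin n) :
    christoffel (warpedMetric G f h) i.succ j.succ k.succ x = christoffel h i j k (Fin.tail x) := by
  have hf := hx.warping_ne_zero
  simp [christoffel, hx.inv_eq, Fin.sum_univ_succ, partialDeriv_succ, partialDeriv_const_mul,
    ← mul_add, ← mul_sub, mul_mul_mul_comm _ _ (f (x 0) ^ 2), hf]

end WarpedProductAt

/-- The conditions on the functions `G` and `f` under which the curvature of a warped product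
`G(t) dt² + f(t)² h` exists and is given by the classical formulas. -/
structure IsWarpingAt (G f : ℝ → ℝ) (t : ℝ) : Prop where
  base_ne_zero : G t ≠ 0
  base_differentiableAt : DifferentiableAt ℝ G t
  warping_ne_zero : f t ≠ 0
  warping_contDiffAt : ContDiffAt ℝ 2 f t

namespace IsWarpingAt

theorem deriv_differentiableAt {t : ℝ} (hGf : IsWarpingAt G f t) :
    DifferentiableAt ℝ (deriv f) t :=
  (hGf.warping_contDiffAt.derivWithin (m := 1) (by norm_num)).differentiableAt one_ne_zero

theorem eventually_warpedProductAt (hGf : IsWarpingAt G f (x 0))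
    (hh : IsMetricNear h (Fin.tail x)) : ∀ᶠ y in 𝓝 x, WarpedProductAt G f h y := by
  have hhead : Tendsto (fun y : Fin (n + 1) → ℝ => y 0) (𝓝 x) (𝓝 (x 0)) :=
    (continuous_apply 0).tendsto x
  have htail : Tendsto (fun y : Fin (n + 1) → ℝ => Fin.tail y) (𝓝 x) (𝓝 (Fin.tail x)) := by
    refine Continuous.tendsto ?_ x
    fun_prop [Fin.tail]
  have hdiff : ∀ᶠ t in 𝓝 (x 0), DifferentiableAt ℝ f t :=
    (hGf.warping_contDiffAt.eventually (by simp)).mono fun t ht => ht.differentiableAt two_ne_zero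
  filter_upwards [hhead.eventually (hGf.base_differentiableAt.continuousAt.eventually_ne
      hGf.base_ne_zero),
    hhead.eventually (hGf.warping_contDiffAt.continuousAt.eventually_ne hGf.warping_ne_zero),
    hhead.eventually hdiff, htail.eventually hh] with y hG hf hf' hhy
  exact ⟨hG, hf, hf', hhy.1, hhy.2⟩

end IsWarpingAt

theorem IsMetricNear.warpedMetric (hh : IsMetricNear h (Fin.tail x)) (hGf : IsWarpingAt G f (x 0)) :
    IsMetricNear (warpedMetric G f h) x :=
  (hGf.eventually_warpedProductAt hh).mono fun _ hy => ⟨hy.isSymm, hy.isUnit_det⟩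

/-- The sectional curvature of the planes of `G(t) dt² + f(t)² h` that contain the direction of
`t`. -/
def radialCurv (G f : ℝ → ℝ) (t : ℝ) : ℝ :=
  deriv f t * deriv G t / (2 * f t * G t ^ 2) - deriv (deriv f) t / (f t * G t)

/-- The sectional curvature of a plane of `G(t) dt² + f(t)² h` tangent to the fibre, in which `h`
has sectional curvature `κ`. -/
def fibreCurv (G f : ℝ → ℝ) (κ t : ℝ) : ℝ :=
  (κ - deriv f t ^ 2 / G t) / f t ^ 2

/-- The sectional curvatures of `G(t) dt² + f(t)² h`, where `κ` are those of `h`. -/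
def warpedCurv (G f : ℝ → ℝ) (κ : Fin n → Fin n → ℝ) (t : ℝ) : Fin (n + 1) → Fin (n + 1) → ℝ :=
  Fin.cons (fun _ => radialCurv G f t)
    fun i => Fin.cons (radialCurv G f t) fun j => fibreCurv G f (κ i j) t

theorem warpedCurv_const (G f : ℝ → ℝ) (k t : ℝ) :
    warpedCurv (n := n) G f (fun _ _ => k) t
      = axialCurv 0 (radialCurv G f t) (fibreCurv G f k t) := by
  ext a b
  cases a using Fin.cases <;> cases b using Fin.cases <;>
    simp only [warpedCurv, axialCurv, Fin.cons_zero, Fin.cons_succ, Fin.succ_ne_zero, true_or,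
      or_true, or_self, if_true, if_false]

namespace IsWarpingAt

section Riemann

variable (hGf : IsWarpingAt G f (x 0)) (hh : IsMetricNear h (Fin.tail x))

include hGf hh

theorem partialDeriv_congr_warped {φ ψ : (Fin (n + 1) → ℝ) → ℝ}
    (hφψ : ∀ y, WarpedProductAt G f h y → φ y = ψ y) (a : Fin (n + 1)) :
    partialDeriv a φ x = partialDeriv a ψ x :=
  partialDeriv_congr ((hGf.eventually_warpedProductAt hh).mono hφψ) a

theorem riemannUp_zero_succ_zero_zero (i : Fin n) :
    riemannUp (warpedMetric G f h) x 0 i.succ 0 0 = 0 := by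
  have hx := (hGf.eventually_warpedProductAt hh).self_of_nhds
  have hmetric := hh.warpedMetric hGf
  rw [riemannUp, partialDeriv_christoffel_comm hmetric,
    partialDeriv_congr_warped hGf hh fun _ hy => hy.christoffel_zero_succ_zero i,
    partialDeriv_congr_warped hGf hh fun _ hy => hy.christoffel_zero_zero_zero]
  simp [Fin.sum_univ_succ, partialDeriv_const, partialDeriv_succ, christoffel_comm hmetric _ 0,
    hx.christoffel_zero_zero_succ, hx.christoffel_zero_succ_zero]

theorem riemannUp_zero_succ_zero_succ (i j : Fin n) :
    riemannUp (warpedMetric G f h) x 0 i.succ 0 j.succ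
      = radialCurv G f (x 0) * G (x 0) * δ i j := by
  have hx := (hGf.eventually_warpedProductAt hh).self_of_nhds
  have hmetric := hh.warpedMetric hGf
  have hG := hGf.base_ne_zero
  have hf := hGf.warping_ne_zero
  rw [riemannUp, partialDeriv_christoffel_comm hmetric,
    partialDeriv_congr_warped hGf hh fun _ hy => hy.christoffel_zero_succ_succ i j,
    partialDeriv_congr_warped hGf hh fun _ hy => hy.christoffel_zero_zero_succ j,
    partialDeriv_zero]
  simp only [Fin.cons_zero, deriv_mul_const_field,
    deriv_fun_div hGf.deriv_differentiableAt hx.differentiableAt_warping hf]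
  simp only [one_apply, mul_ite, mul_one, mul_zero, partialDeriv_const, sub_zero,
    Finset.sum_sub_distrib, Fin.sum_univ_succ, christoffel_comm hmetric (Fin.succ _) 0,
    hx.christoffel_zero_zero_zero, hx.christoffel_zero_zero_succ, hx.christoffel_zero_succ_zero,
    hx.christoffel_zero_succ_succ, zero_mul, Finset.sum_const_zero, add_zero, ite_mul,
    Finset.sum_ite_eq', Finset.mem_univ, if_true, zero_add, radialCurv]
  split_ifs
  · field_simp
    ring
  · ring

theorem riemannUp_zero_succ_succ_zero (i j : Fin n) :
    riemannUp (warpedMetric G f h) x 0 i.succ j.succ 0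
      = -radialCurv G f (x 0) * (f (x 0) ^ 2 * h (Fin.tail x) i j) := by
  have hx := (hGf.eventually_warpedProductAt hh).self_of_nhds
  have hmetric := hh.warpedMetric hGf
  have hG := hGf.base_ne_zero
  have hf := hGf.warping_ne_zero
  rw [riemannUp, partialDeriv_congr_warped hGf hh fun _ hy => hy.christoffel_succ_succ_zero i j,
    partialDeriv_congr_warped hGf hh fun _ hy => hy.christoffel_zero_succ_zero j]
  simp only [partialDeriv_zero, partialDeriv_const, Fin.cons_zero, Fin.tail_cons, deriv.fun_neg',
    deriv_mul_const_field', deriv_fun_div (hx.differentiableAt_warping.fun_mul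
    hGf.deriv_differentiableAt) hGf.base_differentiableAt hG, deriv_fun_mul
    hx.differentiableAt_warping hGf.deriv_differentiableAt, sub_zero, neg_mul, neg_neg, neg_sub,
    sub_neg_eq_add, christoffel_comm hmetric (Fin.succ _) 0, Finset.sum_sub_distrib,
    Fin.sum_univ_succ, hx.christoffel_zero_zero_zero, hx.christoffel_zero_succ_zero,
    hx.christoffel_zero_succ_succ, hx.christoffel_succ_succ_zero, one_apply, mul_ite, mul_one,
    mul_zero, mul_neg, ite_mul, zero_mul, Finset.sum_neg_distrib, Finset.sum_ite_eq,
    Finset.mem_univ, if_true, Finset.sum_const_zero, zero_add, add_zero, hx.fibre_isSymm.apply i j,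
    radialCurv]
  field_simp
  ring

theorem riemannUp_zero_succ_succ_succ (i j k : Fin n) :
    riemannUp (warpedMetric G f h) x 0 i.succ j.succ k.succ = 0 := by
  have hx := (hGf.eventually_warpedProductAt hh).self_of_nhds
  have hmetric := hh.warpedMetric hGf
  rw [riemannUp, partialDeriv_congr_warped hGf hh fun _ hy => hy.christoffel_succ_succ_succ i j k,
    partialDeriv_congr_warped hGf hh fun _ hy => hy.christoffel_zero_succ_succ j k]
  simp [Fin.sum_univ_succ, one_apply, partialDeriv_const, partialDeriv_zero, partialDeriv_succ,
    christoffel_comm hmetric (Fin.succ _) 0, hx.christoffel_zero_zero_succ,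
    hx.christoffel_zero_succ_zero, hx.christoffel_zero_succ_succ, hx.christoffel_succ_succ_succ,
    christoffel_comm hh i j, mul_comm]

theorem riemannUp_succ_succ_zero_zero (i j : Fin n) :
    riemannUp (warpedMetric G f h) x i.succ j.succ 0 0 = 0 := by
  have hx := (hGf.eventually_warpedProductAt hh).self_of_nhds
  have hmetric := hh.warpedMetric hGf
  rw [riemannUp, partialDeriv_christoffel_comm hmetric _ _ 0,
    partialDeriv_christoffel_comm hmetric _ _ 0,
    partialDeriv_congr_warped hGf hh fun _ hy => hy.christoffel_zero_succ_zero i,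
    partialDeriv_congr_warped hGf hh fun _ hy => hy.christoffel_zero_succ_zero j]
  simp [Fin.sum_univ_succ, one_apply, partialDeriv_const,
    christoffel_comm hmetric (Fin.succ _) 0,
    hx.christoffel_zero_succ_zero, hx.christoffel_zero_succ_succ, hx.christoffel_succ_succ_zero,
    hx.fibre_isSymm.apply i j]

theorem riemannUp_succ_succ_zero_succ (i j k : Fin n) :
    riemannUp (warpedMetric G f h) x i.succ j.succ 0 k.succ = 0 := by
  have hx := (hGf.eventually_warpedProductAt hh).self_of_nhds
  have hmetric := hh.warpedMetric hGf
  rw [riemannUp, partialDeriv_christoffel_comm hmetric _ _ 0,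
    partialDeriv_christoffel_comm hmetric _ _ 0,
    partialDeriv_congr_warped hGf hh fun _ hy => hy.christoffel_zero_succ_succ i k,
    partialDeriv_congr_warped hGf hh fun _ hy => hy.christoffel_zero_succ_succ j k]
  simp [Fin.sum_univ_succ, one_apply, partialDeriv_const, partialDeriv_succ,
    christoffel_comm hmetric (Fin.succ _) 0,
    hx.christoffel_zero_succ_zero, hx.christoffel_zero_succ_succ, hx.christoffel_succ_succ_succ,
    christoffel_comm hh i j]

theorem riemannUp_succ_succ_succ_zero (i j k : Fin n) :
    riemannUp (warpedMetric G f h) x i.succ j.succ k.succ 0 = 0 := by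
  have hx := (hGf.eventually_warpedProductAt hh).self_of_nhds
  have hmetric := hh.warpedMetric hGf
  rw [riemannUp, partialDeriv_congr_warped hGf hh fun _ hy => hy.christoffel_succ_succ_zero i k,
    partialDeriv_congr_warped hGf hh fun _ hy => hy.christoffel_succ_succ_zero j k]
  have hi := sum_christoffel_mul hx.fibre_isUnit_det k i j
  have hj := sum_christoffel_mul hx.fibre_isUnit_det k j i
  rw [partialDeriv_metric_comm hh k j i] at hj
  simp only [Fin.sum_univ_succ, Finset.sum_sub_distrib, partialDeriv_succ, partialDeriv_const_mul,
    Fin.cons_zero, Fin.tail_cons, hx.christoffel_succ_succ_zero, hx.christoffel_succ_succ_succ,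
    christoffel_comm hmetric (Fin.succ _) 0, hx.christoffel_zero_succ_zero, mul_zero, zero_add,
    mul_left_comm (christoffel h _ _ _ _), ← Finset.mul_sum, hi, hj]
  rw [partialDeriv_metric_comm hh j i k, partialDeriv_metric_comm hh i j k]
  ring

theorem riemannUp_succ_succ_succ_succ (i j k l : Fin n) :
    riemannUp (warpedMetric G f h) x i.succ j.succ k.succ l.succ
      = riemannUp h (Fin.tail x) i j k l - deriv f (x 0) ^ 2 / G (x 0)
        * (h (Fin.tail x) i k * δ j l - h (Fin.tail x) j k * δ i l) := by
  have hx := (hGf.eventually_warpedProductAt hh).self_of_nhds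
  have hmetric := hh.warpedMetric hGf
  have hf := hGf.warping_ne_zero
  rw [riemannUp, riemannUp,
    partialDeriv_congr_warped hGf hh fun _ hy => hy.christoffel_succ_succ_succ i k l,
    partialDeriv_congr_warped hGf hh fun _ hy => hy.christoffel_succ_succ_succ j k l]
  simp only [Fin.sum_univ_succ, partialDeriv_succ, Fin.tail_cons,
    hx.christoffel_zero_succ_succ, hx.christoffel_succ_succ_zero, hx.christoffel_succ_succ_succ,
    christoffel_comm hmetric (Fin.succ _) 0, hx.fibre_isSymm.apply _ k]
  field_simp
  ring

end Riemann

end IsWarpingAt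

theorem HasSectionalCurvAt.warpedMetric {κ : Fin n → Fin n → ℝ}
    (hh : HasSectionalCurvAt h (Fin.tail x) κ) (hGf : IsWarpingAt G f (x 0)) :
    HasSectionalCurvAt (warpedMetric G f h) x (warpedCurv G f κ (x 0)) where
  isMetricNear := hh.isMetricNear.warpedMetric hGf
  riemannUp_eq a b c d := by
    have hm := hh.isMetricNear
    have hf := hGf.warping_ne_zero
    cases a using Fin.cases <;> cases b using Fin.cases
    case zero.zero => rw [riemannUp_self, sub_self, mul_zero]
    case succ.succ i j =>
      cases c using Fin.cases <;> cases d using Fin.cases <;>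
      simp only [warpedCurv, Fin.cons_succ, hGf.riemannUp_succ_succ_zero_zero hm,
        hGf.riemannUp_succ_succ_zero_succ hm, hGf.riemannUp_succ_succ_succ_zero hm,
        hGf.riemannUp_succ_succ_succ_succ hm, warpedMetric_succ_zero, warpedMetric_succ_succ,
        zero_mul, sub_self, mul_zero, one_apply, Fin.succ_ne_zero, if_false, Fin.succ_inj,
        hh.riemannUp_eq, fibreCurv]
      field_simp
    all_goals
      cases c using Fin.cases <;> cases d using Fin.cases <;>
      simp [warpedCurv, one_apply, riemannUp_swap 0 (Fin.succ _),
        hGf.riemannUp_zero_succ_zero_zero hm, hGf.riemannUp_zero_succ_zero_succ hm,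
        hGf.riemannUp_zero_succ_succ_zero hm, hGf.riemannUp_zero_succ_succ_succ hm,
        (Fin.succ_ne_zero _).symm]

end WarpedProduct

section RobertsonWalker

variable {n : ℕ} {G f : ℝ → ℝ} {h : (Fin n → ℝ) → Matrix (Fin n) (Fin n) ℝ} {k : ℝ}
  {x : Fin (n + 1) → ℝ}

/-- At the point `x`, the metric `G(t) dt² + f(t)² h` is a warped product with a fibre of isotropic
curvature `k`, in orthogonal coordinates: a Robertson–Walker metric, with the sign of `G` left
free. -/
structure IsRobertsonWalkerAt (G f : ℝ → ℝ) (h : (Fin n → ℝ) → Matrix (Fin n) (Fin n) ℝ) (k : ℝ)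
    (x : Fin (n + 1) → ℝ) : Prop where
  isWarpingAt : IsWarpingAt G f (x 0)
  fibre_isDiag : (h (Fin.tail x)).IsDiag
  fibre_isotropic : HasSectionalCurvAt h (Fin.tail x) fun _ _ => k

theorem IsRobertsonWalkerAt.isAxiallyIsotropicAt (hx : IsRobertsonWalkerAt G f h k x) :
    IsAxiallyIsotropicAt (warpedMetric G f h) x 0 (radialCurv G f (x 0))
      (fibreCurv G f k (x 0)) where
  isDiag := isDiag_warpedMetric hx.fibre_isDiag
  hasSectionalCurvAt :=
    warpedCurv_const G f k (x 0) ▸ hx.fibre_isotropic.warpedMetric hx.isWarpingAt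

/-- The scalar curvature of a Robertson–Walker metric with an `n`-dimensional fibre of curvature
`k`. -/
def robertsonWalkerScalar (n : ℕ) (G f : ℝ → ℝ) (k t : ℝ) : ℝ :=
  n * (2 * radialCurv G f t + (n - 1) * fibreCurv G f k t)

/-- The eigenvalue on the fibre of the traceless Ricci tensor of a Robertson–Walker metric with an
`n`-dimensional fibre of curvature `k`. -/
def robertsonWalkerTraceless (n : ℕ) (G f : ℝ → ℝ) (k t : ℝ) : ℝ :=
  (n - 1) * (fibreCurv G f k t - radialCurv G f t) / (n + 1)

theorem robertsonWalkerTraceless_eq (n : ℕ) (G f : ℝ → ℝ) (k t : ℝ) :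
    ((Fintype.card (Fin (n + 1)) : ℝ) - 2) * (fibreCurv G f k t - radialCurv G f t)
        / Fintype.card (Fin (n + 1))
      = robertsonWalkerTraceless n G f k t := by
  rw [robertsonWalkerTraceless, Fintype.card_fin]
  push_cast
  ring

namespace IsRobertsonWalkerAt

theorem scalarCurv_eq (hx : IsRobertsonWalkerAt G f h k x) :
    scalarCurv (warpedMetric G f h) x = robertsonWalkerScalar n G f k (x 0) := by
  rw [hx.isAxiallyIsotropicAt.scalarCurv_eq, robertsonWalkerScalar, Fintype.card_fin]
  push_cast
  ring

theorem tracelessRicciUp_eq (hx : IsRobertsonWalkerAt G f h k x) (a b : Fin (n + 1)) :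
    tracelessRicciUp (warpedMetric G f h) x a b
      = robertsonWalkerTraceless n G f k (x 0) *
        (-((n + 1 : ℕ) : ℝ) * ((if a = 0 then 1 else 0) * (if b = 0 then 1 else 0))
          + (if a = b then 1 else 0)) := by
  rw [hx.isAxiallyIsotropicAt.tracelessRicciUp_eq, robertsonWalkerTraceless_eq, mul_assoc,
    axialEigenvalue, Fintype.card_fin, one_apply]
  congr 1
  obtain rfl | hab := eq_or_ne a b
  · by_cases ha : a = 0 <;> simp only [ha, if_true, if_false] <;> ring
  · have hoff : (if a = 0 then (1 : ℝ) else 0) * (if b = 0 then 1 else 0) = 0 := by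
      rw [ite_zero_mul_ite_zero, if_neg fun h₀ => hab (h₀.1.trans h₀.2.symm)]
    rw [hoff, if_neg hab, mul_zero, mul_zero, add_zero]

theorem invariant_eq (hx : IsRobertsonWalkerAt G f h k x) (m : ℕ) {q : ℕ} (σ : Contraction 0 q) :
    invariant (warpedMetric G f h) m σ x
      = diagonalContraction (axialEigenvalue (0 : Fin (n + 1))) σ
        * robertsonWalkerScalar n G f k (x 0) ^ m * robertsonWalkerTraceless n G f k (x 0) ^ q := by
  have hg := hx.isAxiallyIsotropicAt
  rw [invariant_eq_diagonalContraction hg.isDiag hg.hasSectionalCurvAt.isUnit_det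
    hg.tracelessRicci_eq, robertsonWalkerTraceless_eq, hx.scalarCurv_eq]

theorem invariant_eq_zero (hx : IsRobertsonWalkerAt G f h k x) (hn : 2 ≤ n) (m : ℕ) {p q : ℕ}
    (σ : Contraction p q) (hp : 1 ≤ p) : invariant (warpedMetric G f h) m σ x = 0 :=
  CoordCurv.invariant_eq_zero
    (hx.isAxiallyIsotropicAt.weyl_eq_zero (by rw [Fintype.card_fin]; omega)) m σ hp

end IsRobertsonWalkerAt

end RobertsonWalker

section SpaceForms

variable {n : ℕ}

/-- The round metric on the unit sphere in stereographic coordinates. -/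
def sphereMetric (n : ℕ) : (Fin n → ℝ) → Matrix (Fin n) (Fin n) ℝ :=
  conformalMetric fun y => (1 + ∑ i, y i ^ 2) / 2

theorem hasSectionalCurvAt_sphereMetric (y : Fin n → ℝ) :
    HasSectionalCurvAt (sphereMetric n) y fun _ _ => 1 := by
  have hcoord (y : Fin n → ℝ) (a b : Fin n) : HasPartialDerivAt b (fun z => z a) (1 * δ a b) y := by
    simpa only [HasPartialDerivAt, one_apply, one_mul, Pi.single_apply, eq_comm] using
      hasDerivAt_pi.1 (hasDerivAt_update y b (y b)) a
  have hgrad (y : Fin n → ℝ) (a : Fin n) :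
      HasPartialDerivAt a (fun z => (1 + ∑ i, z i ^ 2) / 2) (y a) y := by
    refine HasDerivAt.congr_deriv ((HasDerivAt.const_add 1 (HasDerivAt.fun_sum fun i _ =>
      HasDerivAt.fun_pow (hcoord y i a) 2)).div_const 2) ?_
    simp only [Function.update_eq_self, one_apply, mul_ite, mul_one, mul_zero, Finset.sum_ite_eq',
      Finset.mem_univ, if_true, Nat.cast_ofNat, Nat.reduceSub, pow_one]
    ring
  have hρ (y : Fin n → ℝ) : (1 + ∑ i, y i ^ 2) / 2 ≠ 0 := by positivity
  have hcurv := hasSectionalCurvAt_conformalMetric (Eventually.of_forall hρ)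
    (Eventually.of_forall fun z a => hgrad z a) (hcoord y)
  have hone : 2 * 1 * ((1 + ∑ i, y i ^ 2) / 2) - ∑ a, y a ^ 2 = 1 := by ring
  simpa only [sphereMetric, hone] using hcurv

/-- The metric `dr² / (1 - k r²) + r² dΩ²` of constant curvature `k`. -/
def spaceMetric (k : ℝ) (n : ℕ) : (Fin (n + 1) → ℝ) → Matrix (Fin (n + 1)) (Fin (n + 1)) ℝ :=
  warpedMetric (fun r => 1 / (1 - k * r ^ 2)) id (sphereMetric n)

variable {k r : ℝ}

theorem isWarpingAt_space (hr : r ≠ 0) (hk : 1 - k * r ^ 2 ≠ 0) :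
    IsWarpingAt (fun r => 1 / (1 - k * r ^ 2)) id r where
  base_ne_zero := one_div_ne_zero hk
  base_differentiableAt := by fun_prop (disch := exact hk)
  warping_ne_zero := hr
  warping_contDiffAt := contDiffAt_id

theorem radialCurv_space (hr : r ≠ 0) (hk : 1 - k * r ^ 2 ≠ 0) :
    radialCurv (fun r => 1 / (1 - k * r ^ 2)) id r = k := by
  have hderiv : deriv (fun r => 1 / (1 - k * r ^ 2)) r = 2 * k * r / (1 - k * r ^ 2) ^ 2 := by
    refine HasDerivAt.deriv (HasDerivAt.congr_deriv ((hasDerivAt_const r (1 : ℝ)).fun_div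
      (((hasDerivAt_pow 2 r).const_mul k).const_sub 1) hk) ?_)
    simp only [Nat.cast_ofNat, Nat.reduceSub, pow_one]
    ring
  simp only [radialCurv, hderiv, deriv_id', id, deriv_const]
  field_simp
  ring

theorem fibreCurv_space (hr : r ≠ 0) :
    fibreCurv (fun r => 1 / (1 - k * r ^ 2)) id 1 r = k := by
  simp only [fibreCurv, deriv_id', id]
  field_simp
  ring

theorem isDiag_spaceMetric (y : Fin (n + 1) → ℝ) : (spaceMetric k n y).IsDiag :=
  isDiag_warpedMetric (isDiag_diagonal _)

theorem hasSectionalCurvAt_spaceMetric {y : Fin (n + 1) → ℝ} (hy : y 0 ≠ 0)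
    (hk : 1 - k * y 0 ^ 2 ≠ 0) : HasSectionalCurvAt (spaceMetric k n) y fun _ _ => k := by
  have hcurv := (hasSectionalCurvAt_sphereMetric (Fin.tail y)).warpedMetric
    (isWarpingAt_space hy hk)
  rwa [warpedCurv_const, radialCurv_space hy hk, fibreCurv_space hy, axialCurv_self] at hcurv

end SpaceForms

end CoordCurv

namespace FLRW

open CoordCurv

variable (B : FLRW) {n : ℕ}

theorem metric_eq (n : ℕ) :
    B.metric n = warpedMetric (fun t => -B.F t) B.a (spaceMetric B.k n) := by
  have hsphere (y : Fin n → ℝ) (c : ℝ) :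
      c * (((1 + ∑ i, y i ^ 2) / 2) ^ 2)⁻¹ = c * (4 / (1 + ∑ i, y i ^ 2) ^ 2) := by
    field_simp
    norm_num
  ext x a b
  obtain rfl | hab := eq_or_ne a b
  · rw [metric, diagonal_apply_eq]
    cases a using Fin.cases with
    | zero => rfl
    | succ i =>
      cases i using Fin.cases with
      | zero => exact div_eq_mul_one_div _ _
      | succ i =>
        simp only [Fin.cons_succ, warpedMetric_succ_succ, spaceMetric, sphereMetric,
          conformalMetric, diagonal_apply_eq, ← mul_assoc, hsphere]
        rfl
  · rw [metric, diagonal_apply_ne _ hab, isDiag_warpedMetric (isDiag_spaceMetric _) hab]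

variable {B}

theorem isRobertsonWalkerAt {x : Fin (n + 2) → ℝ} (hx : x ∈ B.domain n) :
    IsRobertsonWalkerAt (fun t => -B.F t) B.a (spaceMetric B.k n) B.k x where
  isWarpingAt :=
    { base_ne_zero := neg_ne_zero.2 (B.F_pos _ hx.1).ne'
      base_differentiableAt := ((B.F_contDiff.contDiffAt
        (B.times_open.mem_nhds hx.1)).differentiableAt two_ne_zero).neg
      warping_ne_zero := B.a_ne _ hx.1
      warping_contDiffAt := B.a_contDiff.contDiffAt (B.times_open.mem_nhds hx.1) }
  fibre_isDiag := isDiag_spaceMetric _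
  fibre_isotropic :=
    hasSectionalCurvAt_spaceMetric (y := Fin.tail x) hx.2.1.ne' (sub_pos.2 hx.2.2).ne'

theorem radialCurv_eq {t : ℝ} (hF : B.F t ≠ 0) (ha : B.a t ≠ 0) :
    radialCurv (fun t => -B.F t) B.a t = (2 * deriv (deriv B.a) t * B.F t
      - deriv B.a t * deriv B.F t) / (2 * B.a t * B.F t ^ 2) := by
  simp only [radialCurv, deriv.fun_neg]
  field_simp
  ring

theorem fibreCurv_eq {t : ℝ} (hF : B.F t ≠ 0) (ha : B.a t ≠ 0) :
    fibreCurv (fun t => -B.F t) B.a B.k t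
      = (B.k * B.F t + deriv B.a t ^ 2) / (B.a t ^ 2 * B.F t) := by
  rw [fibreCurv]
  field_simp
  ring

theorem Sig_eq (n : ℕ) {t : ℝ} (ht : t ∈ B.times) :
    B.Sig (n + 2) t = robertsonWalkerScalar (n + 1) (fun t => -B.F t) B.a B.k t := by
  have hF := (B.F_pos t ht).ne'
  have ha := B.a_ne t ht
  rw [Sig, robertsonWalkerScalar, radialCurv_eq hF ha, fibreCurv_eq hF ha]
  push_cast
  field_simp
  ring

theorem Gam_eq (n : ℕ) {t : ℝ} (ht : t ∈ B.times) :
    B.Gam (n + 2) t = robertsonWalkerTraceless (n + 1) (fun t => -B.F t) B.a B.k t := by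
  have hF := (B.F_pos t ht).ne'
  have ha := B.a_ne t ht
  rw [Gam, robertsonWalkerTraceless, radialCurv_eq hF ha, fibreCurv_eq hF ha]
  push_cast
  field_simp
  ring

end FLRW

open CoordCurv

theorem proposition2_general (n : ℕ) (hn : 2 ≤ n) :
    (∀ {G f h k x}, IsRobertsonWalkerAt (n := n) G f h k x →
      scalarCurv (warpedMetric G f h) x = robertsonWalkerScalar n G f k (x 0) ∧
      ∀ a b, tracelessRicciUp (warpedMetric G f h) x a b =
        robertsonWalkerTraceless n G f k (x 0) *
          (-((n + 1 : ℕ) : ℝ) * ((if a = 0 then 1 else 0) * (if b = 0 then 1 else 0))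
            + (if a = b then 1 else 0))) ∧
    (∀ (m p q : ℕ) (σ : Contraction p q), 1 ≤ p →
      ∀ {G f h k x}, IsRobertsonWalkerAt (n := n) G f h k x →
        invariant (warpedMetric G f h) m σ x = 0) ∧
    (∀ (m q : ℕ) (σ : Contraction 0 q), ∃ c : ℝ,
      ∀ {G f h k x}, IsRobertsonWalkerAt (n := n) G f h k x →
        invariant (warpedMetric G f h) m σ x =
          c * robertsonWalkerScalar n G f k (x 0) ^ m
            * robertsonWalkerTraceless n G f k (x 0) ^ q) ∧
    (∀ (m p q : ℕ) (σ τ : Contraction p q),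
      (∃ G f h k x, IsRobertsonWalkerAt (n := n) G f h k x ∧
        invariant (warpedMetric G f h) m τ x ≠ 0) →
      ∃ c : ℝ, ∀ {G f h k x}, IsRobertsonWalkerAt (n := n) G f h k x →
        invariant (warpedMetric G f h) m σ x = c * invariant (warpedMetric G f h) m τ x) := by
  refine ⟨fun hx => ⟨hx.scalarCurv_eq, hx.tracelessRicciUp_eq⟩,
    fun m p q σ hp _ _ _ _ _ hx => hx.invariant_eq_zero hn m σ hp,
    fun m q σ => ⟨_, fun hx => hx.invariant_eq m σ⟩, fun m p q σ τ hτ => ?_⟩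
  obtain ⟨G, f, h, k, x, hx, hne⟩ := hτ
  obtain rfl : p = 0 := by
    by_contra hp
    exact hne (hx.invariant_eq_zero hn m τ (Nat.one_le_iff_ne_zero.2 hp))
  have hcτ : diagonalContraction (axialEigenvalue (0 : Fin (n + 1))) τ ≠ 0 := by
    rw [hx.invariant_eq, mul_assoc] at hne
    exact left_ne_zero_of_mul hne
  refine ⟨diagonalContraction (axialEigenvalue (0 : Fin (n + 1))) σ
    / diagonalContraction (axialEigenvalue (0 : Fin (n + 1))) τ, fun hx => ?_⟩
  rw [hx.invariant_eq, hx.invariant_eq]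
  field_simp

end

/-- The dimension is `D = n + 2 ≥ 3`. On every FLRW background:
the Ricci scalar is `Σ` and `Z_a{}^b = Γ (-D δ_a^t δ_t^b + δ_a^b)`;
every invariant with at least one Weyl tensor vanishes;
every invariant with `m` Ricci scalars and `q` traceless Ricci tensors is `c Σ^m Γ^q`, with a real
constant `c` that depends only on the dimension, `m` and the contraction, not on the background;
any two invariants of the same type `(m, p, q)`, the second of which is not zero on all backgrounds,
are proportional to each other. -/
theorem proposition2 (n : ℕ) (hn : 1 ≤ n) :
    (∀ (B : FLRW) (x : Fin (n + 2) → ℝ), x ∈ B.domain n →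
      CoordCurv.scalarCurv (B.metric n) x = B.Sig (n + 2) (x 0) ∧
      ∀ a b : Fin (n + 2), CoordCurv.tracelessRicciUp (B.metric n) x a b =
        B.Gam (n + 2) (x 0) *
          (-((n + 2 : ℕ) : ℝ) * ((if a = 0 then 1 else 0) * (if b = 0 then 1 else 0))
            + (if a = b then 1 else 0))) ∧
    (∀ (m p q : ℕ) (σ : CoordCurv.Contraction p q), 1 ≤ p →
      ∀ (B : FLRW) (x : Fin (n + 2) → ℝ), x ∈ B.domain n →
        CoordCurv.invariant (B.metric n) m σ x = 0) ∧
    (∀ (m q : ℕ) (σ : CoordCurv.Contraction 0 q), ∃ c : ℝ,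
      ∀ (B : FLRW) (x : Fin (n + 2) → ℝ), x ∈ B.domain n →
        CoordCurv.invariant (B.metric n) m σ x =
          c * B.Sig (n + 2) (x 0) ^ m * B.Gam (n + 2) (x 0) ^ q) ∧
    (∀ (m p q : ℕ) (σ τ : CoordCurv.Contraction p q),
      (∃ (B : FLRW) (x : Fin (n + 2) → ℝ), x ∈ B.domain n ∧
        CoordCurv.invariant (B.metric n) m τ x ≠ 0) →
      ∃ c : ℝ, ∀ (B : FLRW) (x : Fin (n + 2) → ℝ), x ∈ B.domain n →
        CoordCurv.invariant (B.metric n) m σ x =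
          c * CoordCurv.invariant (B.metric n) m τ x) := by
  obtain ⟨hcurv, hweyl, hinv, hprop⟩ := proposition2_general (n + 1) (Nat.succ_le_succ hn)
  simp only [FLRW.metric_eq]
  refine ⟨fun B x hx => ?_, fun m p q σ hp B x hx => hweyl m p q σ hp (FLRW.isRobertsonWalkerAt hx),
    fun m q σ => ?_, fun m p q σ τ ⟨B, x, hx, hτ⟩ => ?_⟩
  · rw [FLRW.Sig_eq n hx.1, FLRW.Gam_eq n hx.1]
    exact hcurv (FLRW.isRobertsonWalkerAt hx)
  · obtain ⟨c, hc⟩ := hinv m q σ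
    refine ⟨c, fun B x hx => ?_⟩
    rw [FLRW.Sig_eq n hx.1, FLRW.Gam_eq n hx.1]
    exact hc (FLRW.isRobertsonWalkerAt hx)
  · obtain ⟨c, hc⟩ := hprop m p q σ τ ⟨_, _, _, _, _, FLRW.isRobertsonWalkerAt hx, hτ⟩
    exact ⟨c, fun B x hx => hc (FLRW.isRobertsonWalkerAt hx)⟩
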